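/- Let $d\ge 1$. Throughout, measures on $\mathbb{R}^d\setminus\{0\}$ are nonnegative Radon measures (Borel measures finite on compact subsets of $\mathbb{R}^d\setminus\{0\}$), extended by $\nu(\{0\})=0$ to $\mathbb{R}^d$, with support $\operatorname{supp}(\nu)=\{z\in\mathbb{R}^d\setminus\{0\}:\nu(B_r(z))>0\ \ \forall r>0\}$. Let $\mu$ be such a measure which is symmetric, i.e. $\mu(B)=\mu(-B)$ for all Borel sets $B$, and satisfies $\int(|z|^2\wedge 1)\,d\mu(z)<\infty$. For $\psi\in C_c^\infty(\mathbb{R}^d)$ put $$\mathcal{L}^\mu[\psi](x)=\mathrm{P.V.}\int_{\mathbb{R}^d\setminus\{0\}}\big(\psi(x+z)-\psi(x)\big)\,d\mu(z):=\lim_{r\to0^+}\int_{|z|>r}\big(\psi(x+z)-\psi(x)\big)\,d\mu(z),$$ and for $u\in L^\infty(\mathbb{R}^d)$ let $\mathcal{L}^\mu[u]\in\mathcal{D}'(\mathbb{R}^d)$ be the distribution $\psi\mapsto\int_{\mathbb{R}^d}u\,\mathcal{L}^\mu[\psi]\,dx$. A relative lattice is a subgroup of $\mathbb{R}^d$ generated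 by a basis of some vector subspace of $\mathbb{R}^d$ (so $\{0\}$ is a relative lattice). Then the Liouville property fails for $\mathcal{L}^\mu$, i.e. there is a $u\in L^\infty(\mathbb{R}^d)$, not almost everywhere equal to a constant, such that $\mathcal{L}^\mu[u]=0$ in $\mathcal{D}'(\mathbb{R}^d)$, if and only if there exist a vector subspace $V\subseteq\mathbb{R}^d$, a relative lattice $\Lambda\subseteq\mathbb{R}^d$ and a family $(\mu_a)_{a\in\Lambda}$ of nonnegative Radon measures on $\mathbb{R}^d\setminus\{0\}$ such that 1. $V\neq\mathbb{R}^d$ and $V\cap\operatorname{Span}_{\mathbb{R}}\Lambda=\{0\}$; 2. $\mu_a(B)=\mu_{-a}(-B)$ for all $a\in\Lambda$ and all Borel sets $B$; 3. $\operatorname{supp}(\mu_a)\subseteq V+a$ for all $a\in\Lambda$; 4. $\displaystyle\int(|z|^2\wedge1)\,d\mu_0(z)+\sum_{a\in\Lambda\setminus\{0\}}\mu_a(\mathbb{R}^d)<\infty$; 5. for every $u\in L^\infty(\mathbb{R}^d)$, $$\mathcal{L}^\mu[u](x)=\mathrm{P.V.}\int_{V\setminus\{0\}}\big(u(x+z)-u(x)\big)\,d\mu_0(z)+\sum_{a\in\Lambda\setminus\{0\}}\int_{V+a}\big(u(x+z)-u(x)\big)\,d\mu_a(z)\quad\text{in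 }\mathcal{D}'(\mathbb{R}^d),$$ that is, for all $\psi\in C_c^\infty(\mathbb{R}^d)$ the following series converges and $$\int_{\mathbb{R}^d} u\,\mathcal{L}^\mu[\psi]\,dx=\int_{\mathbb{R}^d} u(x)\,\Big(\mathrm{P.V.}\int_{V\setminus\{0\}}\big(\psi(x+z)-\psi(x)\big)\,d\mu_0(z)\Big)dx+\sum_{a\in\Lambda\setminus\{0\}}\int_{\mathbb{R}^d}\Big(\int_{V+a}\big(u(x+z)-u(x)\big)\,d\mu_a(z)\Big)\psi(x)\,dx.$$ -/

import Mathlib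

open MeasureTheory Filter Topology
open scoped ENNReal Pointwise

namespace LevyLiouville

/-- The Euclidean space `ℝ^d`, with its Euclidean norm, Borel sets and Lebesgue measure. -/
abbrev E (d : ℕ) : Type := EuclideanSpace ℝ (Fin d)

/-- A nonnegative Radon measure on `ℝ^d \ {0}`, encoded as a Borel measure on `ℝ^d` that does not
charge the origin and is finite on the compact subsets of `ℝ^d \ {0}`. -/
def IsPuncturedRadon {d : ℕ} (μ : Measure (E d)) : Prop :=
  μ {0} = 0 ∧ ∀ K : Set (E d), IsCompact K → (0 : E d) ∉ K → μ K < ∞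

/-- The support of a measure on `ℝ^d \ {0}`, as a subset of `ℝ^d \ {0}`: the origin never belongs
to it. -/
def puncturedSupport {d : ℕ} (μ : Measure (E d)) : Set (E d) :=
  {z | z ≠ 0 ∧ ∀ r : ℝ, 0 < r → 0 < μ (Metric.ball z r)}

/-- The quantity `∫ (|z|² ∧ 1) dμ(z)`, with values in `[0, ∞]`. -/
noncomputable def levyMass {d : ℕ} (μ : Measure (E d)) : ℝ≥0∞ :=
  ∫⁻ z, ENNReal.ofReal (min (‖z‖ ^ 2) 1) ∂μ

/-- A symmetric Lévy measure on `ℝ^d \ {0}`. -/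
structure IsSymmetricLevy {d : ℕ} (μ : Measure (E d)) : Prop where
  radon : IsPuncturedRadon μ
  symm : ∀ B : Set (E d), MeasurableSet B → μ B = μ (-B)
  mass : levyMass μ < ∞

/-- `P.V. ∫_{z ≠ 0} (u(x+z) - u(x)) dμ(z)`, the limit as `r → 0+` of the integrals over
`{|z| > r}`. The limit exists when `μ` is a symmetric Lévy measure and `u` is `C²` and bounded with
bounded derivatives up to order two; below it is only applied to test functions. -/
noncomputable def pvOp {d : ℕ} (μ : Measure (E d)) (u : E d → ℝ) (x : E d) : ℝ :=
  limUnder (𝓝[>] (0 : ℝ)) (fun r : ℝ => ∫ z in {z : E d | r < ‖z‖}, (u (x + z) - u x) ∂μ)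

/-- The test functions, `ψ ∈ C_c^∞(ℝ^d)`. -/
def IsTest {d : ℕ} (ψ : E d → ℝ) : Prop :=
  ContDiff ℝ ((⊤ : ℕ∞) : WithTop ℕ∞) ψ ∧ HasCompactSupport ψ

/-- For bounded `u`, the value `∫ u L^μ[ψ] dx` at the test function `ψ` of the distribution
`L^μ[u]`. -/
noncomputable def distOp {d : ℕ} (μ : Measure (E d)) (u ψ : E d → ℝ) : ℝ :=
  ∫ x, u x * pvOp μ ψ x

/-- The Liouville property fails: some `u ∈ L^∞(ℝ^d)` that is not almost everywhere equal to a
constant solves `L^μ[u] = 0` in `D'(ℝ^d)`. -/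
def LiouvilleFails {d : ℕ} (μ : Measure (E d)) : Prop :=
  ∃ u : E d → ℝ, MemLp u ∞ volume ∧ (¬ ∃ c : ℝ, u =ᵐ[volume] fun _ => c) ∧
    ∀ ψ : E d → ℝ, IsTest ψ → distOp μ u ψ = 0

/-- A relative lattice: the subgroup of `ℝ^d` generated by a basis of a vector subspace of `ℝ^d`
(`{0}` being the case of the zero subspace). -/
def IsRelativeLattice {d : ℕ} (Λ : AddSubgroup (E d)) : Prop :=
  ∃ (W : Submodule ℝ (E d)) (n : ℕ) (b : Module.Basis (Fin n) ℝ W),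
    Λ = AddSubgroup.closure (Set.range fun i => (b i : E d))

/-- The affine subspace `V + a`. -/
def translate {d : ℕ} (V : Submodule ℝ (E d)) (a : E d) : Set (E d) :=
  {z | z - a ∈ V}

/-- For bounded `u`, the value at the test function `ψ` of the (bounded) function
`x ↦ ∫_{z ∈ V + a} (u(x+z) - u(x)) dν(z)`, where `ν` is a finite measure. -/
noncomputable def distLayer {d : ℕ} (V : Submodule ℝ (E d)) (a : E d) (ν : Measure (E d))
    (u ψ : E d → ℝ) : ℝ :=
  ∫ x, (∫ z in translate V a, (u (x + z) - u x) ∂ν) * ψ x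

/-- The identity, in `D'(ℝ^d)` and for every `u ∈ L^∞(ℝ^d)`,
`L^μ[u](x) = P.V. ∫_{V \ {0}} (u(x+z) - u(x)) dμ_0(z)
  + ∑_{a ∈ Λ \ {0}} ∫_{V + a} (u(x+z) - u(x)) dμ_a(z)`,
including the convergence of the series in `D'(ℝ^d)`. -/
def HasLayerForm {d : ℕ} (μ : Measure (E d)) (V : Submodule ℝ (E d)) (Λ : AddSubgroup (E d))
    (μs : Λ → Measure (E d)) : Prop :=
  ∀ u : E d → ℝ, MemLp u ∞ volume → ∀ ψ : E d → ℝ, IsTest ψ →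
    Summable (fun a : {a : Λ // a ≠ 0} => distLayer V (a.1 : E d) (μs a.1) u ψ) ∧
    distOp μ u ψ = distOp ((μs 0).restrict (V : Set (E d))) u ψ
      + ∑' a : {a : Λ // a ≠ 0}, distLayer V (a.1 : E d) (μs a.1) u ψ

end LevyLiouville

/-!
For `μ` a symmetric Lévy measure, the principal value defining `L^μ[ψ]` is half the absolutely
convergent integral of the second difference `ψ (x + z) + ψ (x - z) - 2 ψ x` against `μ`
(`pvOp_eq`), so that `⟨L^μ[u], ψ⟩` is, by Fubini, an integral over the jumps `z` (`distOp_eq`).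
The theorem holds because a bounded solution is periodic with respect to the closed group generated
by the support of `μ`, and a closed group that is not the whole space splits into a proper subspace
and a relative lattice.

*A solution is periodic.* Correlating a solution `u` with a test function gives a bounded Lipschitz
function `U` with `∫ secondDiff U x z dμ(z) = 0` for every `x`. Let `z₀` be in the support of `μ`
and let `M` be the supremum of `v = U (· + z₀) - U`. Where `v` is almost equal to `M`, so it is
after a translation by `z₀`, since otherwise the values of `v` below `M` near `x + z₀` would make
the integral of `secondDiff v x` negative (`exists_almost_max_add`). Iterating, `U` increases by
almost `M` along each of `k` consecutive steps, so `M ≤ 0` because `U` is bounded. Hence `z₀`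
belongs to the closed group `periods u` of distributional periods of `u`
(`puncturedSupport_subset_periods`), and this group is not the whole space if `u` is not constant
(`ae_const_of_periods_eq_top`).

*Structure of the group of periods.* A closed subgroup `G` of `ℝ^d` is `V ⊕ Λ`, where `V` is the
largest vector subspace in `G` and `Λ = G ∩ Vᗮ` is discrete
(`exists_le_norm_of_mem_orthogonalPart`), thus a relative lattice. The measures `μ_a` are the
restrictions of `μ` to the layers `V + a`; as `Λ` is orthogonal to `V`, all layers but `V` stay away
from the origin and have finite total mass, and the layer form of `L^μ` follows by splitting the
integral over the jumps (`hasLayerForm_restrict`).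

*Converse.* Given `V` and `Λ`, some nonzero linear form `l` vanishes on `V` and is integral on `Λ`
(`exists_linearMap_int`). The function `cos (2π l x)` is bounded, not constant and invariant under
every `V + a`, so each term of the layer form vanishes on it.
-/

namespace LevyLiouville

variable {d : ℕ}

/-! ### First and second differences of test functions -/

/-- The symmetric second difference `f (x + z) + f (x - z) - 2 f x`. -/
def secondDiff (f : E d → ℝ) (x z : E d) : ℝ := f (x + z) + f (x - z) - 2 * f x

/-- The integrand `|z|² ∧ 1` of the Lévy condition. -/
noncomputable def levyWeight (z : E d) : ℝ := min (‖z‖ ^ 2) 1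

lemma levyWeight_nonneg (z : E d) : 0 ≤ levyWeight z := le_min (by positivity) zero_le_one

lemma continuous_levyWeight : Continuous (levyWeight : E d → ℝ) := by
  unfold levyWeight; fun_prop

lemma le_mul_levyWeight {a A B : ℝ} (z : E d) (h1 : a ≤ A * ‖z‖ ^ 2) (h2 : a ≤ B) (hA : 0 ≤ A)
    (hB : 0 ≤ B) : a ≤ (A + B) * levyWeight z := by
  unfold levyWeight
  rcases min_cases (‖z‖ ^ 2) 1 with ⟨h, _⟩ | ⟨h, _⟩ <;> rw [h] <;>
    nlinarith [mul_nonneg hB (sq_nonneg ‖z‖)]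

lemma IsTest.continuous {ψ : E d → ℝ} (hψ : IsTest ψ) : Continuous ψ := hψ.1.continuous

lemma IsTest.integrable {ψ : E d → ℝ} (hψ : IsTest ψ) : Integrable ψ :=
  hψ.continuous.integrable_of_hasCompactSupport hψ.2

lemma IsTest.comp_add_right {ψ : E d → ℝ} (hψ : IsTest ψ) (a : E d) :
    IsTest fun x => ψ (x + a) :=
  ⟨hψ.1.comp (by fun_prop), hψ.2.comp_homeomorph (Homeomorph.addRight a)⟩

lemma IsTest.comp_sub_right {ψ : E d → ℝ} (hψ : IsTest ψ) (a : E d) :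
    IsTest fun x => ψ (x - a) := by
  simpa [sub_eq_add_neg] using hψ.comp_add_right (-a)

lemma IsTest.exists_abs_le {ψ : E d → ℝ} (hψ : IsTest ψ) : ∃ M, 0 ≤ M ∧ ∀ x, |ψ x| ≤ M := by
  obtain ⟨M, hM⟩ := hψ.2.exists_bound_of_continuous hψ.continuous
  exact ⟨M, (norm_nonneg _).trans (hM 0), hM⟩

lemma IsTest.exists_lipschitz {ψ : E d → ℝ} (hψ : IsTest ψ) :
    ∃ L, 0 ≤ L ∧ ∀ x z, |ψ (x + z) - ψ x| ≤ L * ‖z‖ := by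
  obtain ⟨L, hL⟩ := ContDiff.lipschitzWith_of_hasCompactSupport hψ.2 hψ.1 (by simp)
  refine ⟨L, L.2, fun x z => ?_⟩
  simpa [Real.dist_eq] using hL.dist_le_mul (x + z) x

/-- The difference `y ↦ ψ (y + z) - ψ y` is Lipschitz with a constant of order `|z|`, because the
derivative of `ψ` is Lipschitz; the second difference is an increment of it. -/
lemma IsTest.exists_abs_secondDiff_le {ψ : E d → ℝ} (hψ : IsTest ψ) :
    ∃ C, 0 ≤ C ∧ ∀ x z, |secondDiff ψ x z| ≤ C * levyWeight z := by
  obtain ⟨K, hK⟩ := ContDiff.lipschitzWith_of_hasCompactSupport (n := ((⊤ : ℕ∞) : WithTop ℕ∞))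
    (hψ.2.fderiv (𝕜 := ℝ))
    (hψ.1.fderiv_right le_rfl) (by simp)
  obtain ⟨M, hM0, hM⟩ := hψ.exists_abs_le
  refine ⟨K + 4 * M, by positivity, fun x z => le_mul_levyWeight z ?_ ?_ K.2 (by positivity)⟩
  · have hd : ∀ y, HasFDerivAt (fun y => ψ (y + z) - ψ y)
      (fderiv ℝ ψ (y + z) - fderiv ℝ ψ y) y := by
      intro y
      have h1 : ∀ w, HasFDerivAt ψ (fderiv ℝ ψ w) w := fun w =>
        (hψ.1.differentiable (by simp) w).hasFDerivAt
      exact ((hasFDerivAt_comp_add_right z).2 (h1 (y + z))).sub (h1 y)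
    have h := Convex.norm_image_sub_le_of_norm_hasFDerivWithin_le (𝕜 := ℝ) (s := Set.univ)
      (f := fun y => ψ (y + z) - ψ y) (C := K * ‖z‖) (x := x - z) (y := x)
      (fun y _ => (hd y).hasFDerivWithinAt)
      (fun y _ => by simpa [dist_eq_norm] using hK.dist_le_mul (y + z) y)
      convex_univ trivial trivial
    calc |secondDiff ψ x z| = ‖(ψ (x + z) - ψ x) - (ψ (x - z + z) - ψ (x - z))‖ := by
          rw [Real.norm_eq_abs, sub_add_cancel, secondDiff]; congr 1; ring
      _ ≤ _ := h
      _ = K * ‖z‖ ^ 2 := by rw [sub_sub_cancel]; ring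
  · have h1 := abs_le.1 (hM (x + z))
    have h2 := abs_le.1 (hM (x - z))
    have h3 := abs_le.1 (hM x)
    rw [secondDiff, abs_le]
    constructor <;> linarith

lemma integral_abs_le_of_support {f : E d → ℝ} {s : Set (E d)} {B m : ℝ} (hB : ∀ x, |f x| ≤ B)
    (hs : ∀ x, x ∉ s → f x = 0) (hm : 0 ≤ m) (hvol : volume s ≤ ENNReal.ofReal m) :
    ∫ x, |f x| ≤ B * m := by
  have hB0 : 0 ≤ B := (abs_nonneg _).trans (hB 0)
  rw [← setIntegral_eq_integral_of_forall_compl_eq_zero (s := s)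
    (fun x hx => by rw [hs x hx, abs_zero])]
  refine (Real.le_norm_self _).trans ((norm_setIntegral_le_of_norm_le_const (C := B)
    (hvol.trans_lt ENNReal.ofReal_lt_top) (fun x _ => by simpa using hB x)).trans ?_)
  gcongr
  exact ENNReal.toReal_le_of_le_ofReal hm hvol

lemma volume_preimage_add_right (s : Set (E d)) (z : E d) :
    volume ((fun x => x + z) ⁻¹' s) = volume s := measure_preimage_add_right _ _ _

lemma volume_preimage_sub_right (s : Set (E d)) (z : E d) :
    volume ((fun x => x - z) ⁻¹' s) = volume s := by
  simp [sub_eq_add_neg]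

lemma IsTest.exists_volume_support {ψ : E d → ℝ} (hψ : IsTest ψ) :
    ∃ m, 0 ≤ m ∧ volume (Function.support ψ) ≤ ENNReal.ofReal m := by
  refine ⟨(volume (Function.support ψ)).toReal, ENNReal.toReal_nonneg, ?_⟩
  rw [ENNReal.ofReal_toReal]
  exact ((measure_mono (subset_tsupport ψ)).trans_lt hψ.2.isCompact.measure_lt_top).ne

lemma IsTest.integrable_secondDiff {ψ : E d → ℝ} (hψ : IsTest ψ) (z : E d) :
    Integrable fun x => secondDiff ψ x z :=
  ((hψ.comp_add_right z).integrable.add (hψ.comp_sub_right z).integrable).sub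
    (hψ.integrable.const_mul 2)

/-- The constant is uniform in `z`, because the second difference vanishes outside three translates
of the support. -/
lemma IsTest.exists_integral_abs_secondDiff_le {ψ : E d → ℝ} (hψ : IsTest ψ) :
    ∃ C, 0 ≤ C ∧ ∀ z, ∫ x, |secondDiff ψ x z| ≤ C * levyWeight z := by
  obtain ⟨C, hC0, hC⟩ := hψ.exists_abs_secondDiff_le
  obtain ⟨m, hm0, hm⟩ := hψ.exists_volume_support
  refine ⟨C * (3 * m), by positivity, fun z => ?_⟩
  set S := Function.support ψ
  refine (integral_abs_le_of_support (m := 3 * m)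
    (s := ((fun x => x + z) ⁻¹' S ∪ (fun x => x - z) ⁻¹' S) ∪ S) (fun x => hC x z) ?_
    (by positivity) ?_).trans (by nlinarith)
  · intro x hx
    simp only [Set.mem_union, Set.mem_preimage, S, Function.mem_support, not_or, not_not] at hx
    simp [secondDiff, hx.1.1, hx.1.2, hx.2]
  · refine (measure_union_le _ _).trans ((add_le_add_left (measure_union_le _ _) _).trans ?_)
    rw [volume_preimage_add_right, volume_preimage_sub_right,
      show 3 * m = m + m + m by ring, ENNReal.ofReal_add (by positivity) hm0,
      ENNReal.ofReal_add hm0 hm0]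
    gcongr

lemma IsTest.exists_integral_abs_diff_le {ψ : E d → ℝ} (hψ : IsTest ψ) :
    ∃ L, 0 ≤ L ∧ ∀ z, ∫ x, |ψ (x + z) - ψ x| ≤ L * ‖z‖ := by
  obtain ⟨C, hC0, hC⟩ := hψ.exists_lipschitz
  obtain ⟨m, hm0, hm⟩ := hψ.exists_volume_support
  refine ⟨C * (2 * m), by positivity, fun z => ?_⟩
  set S := Function.support ψ
  refine (integral_abs_le_of_support (m := 2 * m)
    (s := (fun x => x + z) ⁻¹' S ∪ S) (fun x => hC x z) ?_
    (by positivity) ?_).trans (by nlinarith)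
  · intro x hx
    simp only [Set.mem_union, Set.mem_preimage, S, Function.mem_support, not_or, not_not] at hx
    simp [hx.1, hx.2]
  · refine (measure_union_le _ _).trans ?_
    rw [volume_preimage_add_right, show 2 * m = m + m by ring, ENNReal.ofReal_add hm0 hm0]
    gcongr

/-! ### The principal value as an absolutely convergent integral -/

lemma integrable_levyWeight {ν : Measure (E d)} (hν : levyMass ν < ∞) :
    Integrable levyWeight ν :=
  ⟨continuous_levyWeight.aestronglyMeasurable, by
    rw [hasFiniteIntegral_iff_ofReal (ae_of_all _ levyWeight_nonneg)]; exact hν⟩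

lemma measure_norm_gt_lt_top {ν : Measure (E d)} (hν : levyMass ν < ∞) {r : ℝ} (hr : 0 < r) :
    ν {z | r < ‖z‖} < ∞ := by
  have h := (integrable_levyWeight hν).measure_ge_lt_top (ε := min (r ^ 2) 1) (by positivity)
  refine (measure_mono fun z hz => ?_).trans_lt h
  have hz' : r < ‖z‖ := hz
  simp only [levyWeight, Set.mem_ofPred_eq]
  gcongr

/-- The sets `{|z| > 1 / (n + 1)} ∪ {0}` have finite measure and exhaust the space. -/
lemma sigmaFinite_of_levyMass {ν : Measure (E d)} (hν : levyMass ν < ∞) (h0 : ν {0} = 0) :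
    SigmaFinite ν := by
  refine ⟨⟨⟨fun n : ℕ => {z | 1 / (n + 1 : ℝ) < ‖z‖} ∪ {0}, fun _ => trivial, fun n => ?_, ?_⟩⟩⟩
  · refine (measure_union_le _ _).trans_lt ?_
    rw [h0, add_zero]
    exact measure_norm_gt_lt_top hν (by positivity)
  · refine Set.eq_univ_of_forall fun z => Set.mem_iUnion.2 ?_
    by_cases hz : z = 0
    · exact ⟨0, Or.inr hz⟩
    · obtain ⟨n, hn⟩ := exists_nat_one_div_lt (norm_pos_iff.2 hz)
      exact ⟨n, Or.inl hn⟩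

lemma isNegInvariant_of_symm {ν : Measure (E d)}
    (h : ∀ B : Set (E d), MeasurableSet B → ν B = ν (-B)) : ν.IsNegInvariant := by
  refine ⟨Measure.ext fun B hB => ?_⟩
  rw [Measure.neg_apply, ← h B hB]

lemma continuous_secondDiff {f : E d → ℝ} (hf : Continuous f) :
    Continuous fun p : E d × E d => secondDiff f p.1 p.2 := by
  unfold secondDiff; fun_prop

lemma integrable_secondDiff_right {ν : Measure (E d)} (hν : levyMass ν < ∞) {f : E d → ℝ}
    (hf : Continuous f) {C : ℝ} {x : E d} (hC : ∀ z, |secondDiff f x z| ≤ C * levyWeight z) :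
    Integrable (secondDiff f x) ν :=
  ((integrable_levyWeight hν).const_mul C).mono'
    ((continuous_secondDiff hf).comp
      (by fun_prop : Continuous fun z => (x, z))).aestronglyMeasurable
    (ae_of_all _ hC)

lemma measurableSet_norm_gt (r : ℝ) : MeasurableSet {z : E d | r < ‖z‖} :=
  measurableSet_lt measurable_const measurable_norm

/-- For a symmetric Lévy measure the principal value is half the absolutely convergent integral of
the second difference. -/
lemma pvOp_eq {ν : Measure (E d)} [ν.IsNegInvariant] (hν : levyMass ν < ∞) {ψ : E d → ℝ}
    (hψ : IsTest ψ) (x : E d) : pvOp ν ψ x = ∫ z, secondDiff ψ x z / 2 ∂ν := by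
  obtain ⟨C, hC0, hC⟩ := hψ.exists_abs_secondDiff_le
  obtain ⟨M, hM0, hM⟩ := hψ.exists_abs_le
  have hint := integrable_secondDiff_right hν hψ.continuous (hC x)
  -- reflecting the domain of integration symmetrizes the integrand
  have key : ∀ r : ℝ, 0 < r → ∫ z in {z : E d | r < ‖z‖}, (ψ (x + z) - ψ x) ∂ν =
      ∫ z, {z : E d | r < ‖z‖}.indicator (fun z => secondDiff ψ x z / 2) z ∂ν := by
    intro r hr
    have : IsFiniteMeasure (ν.restrict {z : E d | r < ‖z‖}) :=
      ⟨by simpa using measure_norm_gt_lt_top hν hr⟩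
    have hI : ∀ g : E d → E d, Continuous g →
        Integrable (fun z => ψ (g z) - ψ x) (ν.restrict {z : E d | r < ‖z‖}) := fun g hg =>
      Integrable.of_bound ((hψ.continuous.comp hg).sub continuous_const).aestronglyMeasurable
        (M + M) (ae_of_all _ fun z => (norm_sub_le _ _).trans (add_le_add (hM _) (hM _)))
    have hneg : ∫ z in {z : E d | r < ‖z‖}, (ψ (x - z) - ψ x) ∂ν =
        ∫ z in {z : E d | r < ‖z‖}, (ψ (x + z) - ψ x) ∂ν := by
      rw [← integral_indicator (measurableSet_norm_gt r),
        ← integral_indicator (measurableSet_norm_gt r), ← integral_neg_eq_self]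
      congr 1 with z
      simp [Set.indicator]
    rw [integral_indicator (measurableSet_norm_gt r)]
    have : ∫ z in {z : E d | r < ‖z‖}, secondDiff ψ x z / 2 ∂ν =
        ((∫ z in {z : E d | r < ‖z‖}, (ψ (x + z) - ψ x) ∂ν)
          + ∫ z in {z : E d | r < ‖z‖}, (ψ (x - z) - ψ x) ∂ν) / 2 := by
      rw [← integral_add (hI _ (by fun_prop)) (hI _ (by fun_prop)), ← integral_div]
      congr 1 with z
      simp only [secondDiff]; ring
    rw [this, hneg]; ring
  refine Tendsto.limUnder_eq (Tendsto.congr' (f₁ := fun r : ℝ =>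
    ∫ z, {z : E d | r < ‖z‖}.indicator (fun z => secondDiff ψ x z / 2) z ∂ν) ?_ ?_)
  · filter_upwards [self_mem_nhdsWithin] with r hr using (key r hr).symm
  · refine tendsto_integral_filter_of_dominated_convergence
      (fun z => |secondDiff ψ x z / 2|) ?_ ?_ (hint.div_const 2).abs ?_
    · exact Eventually.of_forall fun r => (hint.div_const 2).aestronglyMeasurable.indicator
        (measurableSet_norm_gt r)
    · exact Eventually.of_forall fun r => ae_of_all _ fun z => norm_indicator_le_norm_self _ _
    · refine ae_of_all _ fun z => ?_
      by_cases hz : z = 0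
      · have : ∀ r : ℝ, {z : E d | r < ‖z‖}.indicator (fun z => secondDiff ψ x z / 2) z =
            secondDiff ψ x z / 2 := by
          intro r
          have : secondDiff ψ x z = 0 := by simp [secondDiff, hz]; ring
          simp [Set.indicator, this]
        simpa only [this] using tendsto_const_nhds
      · refine tendsto_const_nhds.congr' ?_
        filter_upwards [nhdsWithin_le_nhds (Iio_mem_nhds (norm_pos_iff.2 hz))] with r hr
        exact (Set.indicator_of_mem (s := {z : E d | r < ‖z‖}) hr
          (fun z => secondDiff ψ x z / 2)).symm

/-! ### Pairing with bounded functions -/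

lemma exists_ae_abs_le {u : E d → ℝ} (hu : MemLp u ∞ volume) :
    ∃ K, 0 ≤ K ∧ ∀ᵐ x, |u x| ≤ K := by
  refine ⟨(eLpNorm u ∞ volume).toReal, ENNReal.toReal_nonneg, ?_⟩
  rw [eLpNorm_exponent_top]
  filter_upwards [enorm_ae_le_eLpNormEssSup u volume] with x hx
  have := ENNReal.toReal_mono (by simpa [eLpNorm_exponent_top] using hu.2.ne) hx
  simpa using this

lemma integrable_bdd_mul {u f : E d → ℝ} (hu : MemLp u ∞ volume) (hf : Integrable f) :
    Integrable fun x => u x * f x := by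
  obtain ⟨K, _, hK⟩ := exists_ae_abs_le hu
  exact hf.bdd_mul hu.1 hK

lemma abs_integral_mul_le {u f : E d → ℝ} {K : ℝ} (hK : ∀ᵐ x, |u x| ≤ K)
    (hf : Integrable f) : |∫ x, u x * f x| ≤ K * ∫ x, |f x| := by
  rw [← integral_const_mul, ← Real.norm_eq_abs]
  refine norm_integral_le_of_norm_le (hf.abs.const_mul K) ?_
  filter_upwards [hK] with x hx
  rw [norm_mul]
  exact mul_le_mul_of_nonneg_right hx (abs_nonneg _)

lemma integrable_prod_mul_secondDiff {ν : Measure (E d)} [SFinite ν] (hν : levyMass ν < ∞)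
    {u ψ : E d → ℝ} (hu : MemLp u ∞ volume) (hψ : IsTest ψ) :
    Integrable (fun p : E d × E d => u p.1 * secondDiff ψ p.1 p.2) (volume.prod ν) := by
  obtain ⟨K, hK0, hK⟩ := exists_ae_abs_le hu
  obtain ⟨C, hC0, hC⟩ := hψ.exists_integral_abs_secondDiff_le
  have hsd : Integrable (fun p : E d × E d => secondDiff ψ p.1 p.2) (volume.prod ν) := by
    have hm := (continuous_secondDiff hψ.continuous).aestronglyMeasurable
      (μ := (volume : Measure (E d)).prod ν)
    refine (integrable_prod_iff' hm).2 ⟨ae_of_all _ fun z => hψ.integrable_secondDiff z, ?_⟩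
    refine ((integrable_levyWeight hν).const_mul C).mono' hm.norm.prod_swap.integral_prod_right'
      (ae_of_all _ fun z => ?_)
    rw [Real.norm_of_nonneg (integral_nonneg fun _ => norm_nonneg _)]
    exact hC z
  exact hsd.bdd_mul hu.1.comp_fst (Measure.quasiMeasurePreserving_fst.ae hK)

/-- By Fubini, the pairing `⟨L^ν[u], ψ⟩` is an integral over the jumps `z`. -/
lemma distOp_eq {ν : Measure (E d)} [SFinite ν] [ν.IsNegInvariant] (hν : levyMass ν < ∞)
    {u ψ : E d → ℝ} (hu : MemLp u ∞ volume) (hψ : IsTest ψ) :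
    distOp ν u ψ = ∫ z, (∫ x, u x * secondDiff ψ x z) / 2 ∂ν := by
  have h := integral_integral_swap (f := fun x z => u x * secondDiff ψ x z)
    (integrable_prod_mul_secondDiff hν hu hψ)
  calc distOp ν u ψ = ∫ x, (∫ z, u x * secondDiff ψ x z ∂ν) / 2 := by
        refine integral_congr_ae (ae_of_all _ fun x => ?_)
        simp only [pvOp_eq hν hψ, integral_div, integral_const_mul, mul_div_assoc]
    _ = _ := by rw [integral_div, integral_div, h]

lemma integrable_integral_mul_secondDiff {ν : Measure (E d)} [SFinite ν] (hν : levyMass ν < ∞)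
    {u ψ : E d → ℝ} (hu : MemLp u ∞ volume) (hψ : IsTest ψ) :
    Integrable (fun z => ∫ x, u x * secondDiff ψ x z) ν :=
  (integrable_prod_mul_secondDiff hν hu hψ).integral_prod_right

/-! ### The maximum principle and periodicity of regular solutions -/

/-- A form of the strong maximum principle that needs no maximum point: if `v` is almost maximal
at `x`, it is almost maximal at `x + z₀` for each `z₀` in the support of the measure. -/
lemma exists_almost_max_add {μ : Measure (E d)} (hμ : levyMass μ < ∞) {z₀ : E d}
    (hz₀ : z₀ ∈ puncturedSupport μ) {v : E d → ℝ} {L C M : ℝ} (hv : Continuous v) (hL0 : 0 ≤ L)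
    (hL : ∀ x z, |v (x + z) - v x| ≤ L * ‖z‖) (hC0 : 0 ≤ C)
    (hC : ∀ x z, |secondDiff v x z| ≤ C * levyWeight z)
    (h0 : ∀ x, ∫ z, secondDiff v x z ∂μ = 0) (hM : ∀ x, v x ≤ M) {ε : ℝ} (hε : 0 < ε) :
    ∃ δ > 0, ∀ x, M - δ < v x → M - ε < v (x + z₀) := by
  -- on the ball of radius `ρ` about `z₀`, which avoids the origin, `v (x + ·)` varies by at most
  -- `ε / 2`
  set ρ : ℝ := min (ε / (2 * (L + 1))) (‖z₀‖ / 2)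
  have hz₀n : 0 < ‖z₀‖ := norm_pos_iff.2 hz₀.1
  have hρ : 0 < ρ := lt_min (by positivity) (by positivity)
  have hLρ : L * ρ ≤ ε / 2 := by
    calc L * ρ ≤ (L + 1) * (ε / (2 * (L + 1))) := by
          gcongr
          · linarith
          · exact min_le_left _ _
      _ = ε / 2 := by field_simp
  set B := Metric.ball z₀ ρ
  have hBfin : μ B < ∞ := by
    refine (measure_mono fun z hz => ?_).trans_lt (measure_norm_gt_lt_top hμ (half_pos hz₀n))
    have h1 : ‖z - z₀‖ < ‖z₀‖ / 2 := (mem_ball_iff_norm.1 hz).trans_le (min_le_right _ _)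
    have h2 := norm_sub_norm_le z₀ z
    rw [norm_sub_rev] at h2
    show ‖z₀‖ / 2 < ‖z‖
    linarith
  have hm : 0 < μ.real B := ENNReal.toReal_pos (hz₀.2 ρ hρ).ne' hBfin.ne
  have hCw : ∀ z : E d, 0 ≤ C * levyWeight z := fun z => mul_nonneg hC0 (levyWeight_nonneg z)
  have hwc : ∀ t : ℝ, Continuous fun z : E d => min (2 * t) (C * levyWeight z) := fun t =>
    continuous_const.min (continuous_const.mul continuous_levyWeight)
  have hwb : ∀ t : ℝ, 0 < t → ∀ z : E d, ‖min (2 * t) (C * levyWeight z)‖ ≤ C * levyWeight z := by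
    intro t ht z
    rw [Real.norm_of_nonneg (le_min (by positivity) (hCw z))]
    exact min_le_right _ _
  -- `min (2 t) (C (|z|² ∧ 1))` bounds the second difference at a point where `v > M - t`; its
  -- integral is small with `t` even though `μ` may be infinite near the origin
  have hlim : Tendsto (fun t : ℝ => ∫ z, min (2 * t) (C * levyWeight z) ∂μ) (𝓝[>] 0)
      (𝓝 (∫ _ : E d, (0 : ℝ) ∂μ)) := by
    refine tendsto_integral_filter_of_dominated_convergence (fun z => C * levyWeight z) ?_ ?_
      ((integrable_levyWeight hμ).const_mul C) (ae_of_all _ fun z => ?_)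
    · exact Eventually.of_forall fun t => (hwc t).aestronglyMeasurable
    · filter_upwards [self_mem_nhdsWithin] with t ht using ae_of_all _ (hwb t ht)
    · have h : Tendsto (fun t : ℝ => min (2 * t) (C * levyWeight z)) (𝓝 0)
          (𝓝 (min (2 * 0) (C * levyWeight z))) :=
        Continuous.tendsto (by fun_prop) 0
      rw [mul_zero, min_eq_left (hCw z)] at h
      exact h.mono_left nhdsWithin_le_nhds
  rw [integral_zero] at hlim
  obtain ⟨t, ht0, htε, htlt⟩ := (eventually_mem_nhdsWithin.and
    ((eventually_nhdsWithin_of_eventually_nhds (eventually_lt_nhds (by positivity : 0 < ε / 8))).and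
      (hlim.eventually_lt_const (by positivity : 0 < ε / 4 * μ.real B)))).exists
  replace ht0 : 0 < t := ht0
  refine ⟨t, ht0, fun x hx => ?_⟩
  by_contra! hcon
  have hwi : Integrable (fun z => min (2 * t) (C * levyWeight z)) μ :=
    ((integrable_levyWeight hμ).const_mul C).mono' (hwc t).aestronglyMeasurable
      (ae_of_all _ (hwb t ht0))
  have hBi : Integrable (B.indicator fun _ => ε / 4) μ :=
    (integrable_indicator_iff measurableSet_ball).2 (integrableOn_const hBfin.ne)
  -- on the ball, `v (x + z) ≤ M - ε / 2` pulls the second difference below `2 t - ε / 2 ≤ -ε / 4`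
  have hle : ∀ z, secondDiff v x z ≤
      min (2 * t) (C * levyWeight z) - B.indicator (fun _ => ε / 4) z := by
    intro z
    have h1 := hM (x + z)
    have h2 := hM (x - z)
    by_cases hz : z ∈ B
    · rw [Set.indicator_of_mem hz]
      have h3 : 0 ≤ min (2 * t) (C * levyWeight z) := le_min (by positivity) (hCw z)
      have h4 : v (x + z) - v (x + z₀) ≤ L * ρ := by
        have h5 := (abs_le.1 (hL (x + z₀) (z - z₀))).2
        rw [show x + z₀ + (z - z₀) = x + z by abel] at h5
        refine h5.trans ?_
        gcongr
        exact (mem_ball_iff_norm.1 hz).le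
      rw [secondDiff]
      linarith
    · rw [Set.indicator_of_notMem hz, sub_zero]
      refine le_min ?_ ((le_abs_self _).trans (hC x z))
      rw [secondDiff]
      linarith
  have := integral_mono (integrable_secondDiff_right hμ hv (hC x)) (hwi.sub hBi) hle
  simp only [Pi.sub_apply] at this
  rw [h0 x, integral_sub hwi hBi, integral_indicator measurableSet_ball, setIntegral_const,
    smul_eq_mul] at this
  linarith

lemma exists_almost_max_nsmul {μ : Measure (E d)} (hμ : levyMass μ < ∞) {z₀ : E d}
    (hz₀ : z₀ ∈ puncturedSupport μ) {v : E d → ℝ} {L C M : ℝ} (hv : Continuous v) (hL0 : 0 ≤ L)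
    (hL : ∀ x z, |v (x + z) - v x| ≤ L * ‖z‖) (hC0 : 0 ≤ C)
    (hC : ∀ x z, |secondDiff v x z| ≤ C * levyWeight z)
    (h0 : ∀ x, ∫ z, secondDiff v x z ∂μ = 0) (hM : ∀ x, v x ≤ M) (k : ℕ) {ε : ℝ} (hε : 0 < ε) :
    ∃ δ > 0, ∀ x, M - δ < v x → ∀ j < k, M - ε < v (x + j • z₀) := by
  induction k with
  | zero => exact ⟨1, one_pos, fun x _ j hj => absurd hj (Nat.not_lt_zero j)⟩
  | succ k ih =>
    obtain ⟨δ, hδ, H⟩ := ih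
    obtain ⟨δ', hδ', H'⟩ := exists_almost_max_add hμ hz₀ hv hL0 hL hC0 hC h0 hM hδ
    refine ⟨min ε δ', lt_min hε hδ', fun x hx j hj => ?_⟩
    have h1 := min_le_left ε δ'
    have h2 := min_le_right ε δ'
    cases j with
    | zero => rw [zero_smul, add_zero]; linarith
    | succ j =>
      rw [succ_nsmul', ← add_assoc]
      exact H (x + z₀) (H' x (by linarith)) j (by omega)

/-- The increment `v = U (· + z₀) - U` cannot have a positive supremum: it would be almost attained
at `x, x + z₀, …, x + k z₀`, and summing the increments contradicts the boundedness of `U`. -/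
lemma add_le_of_integral_secondDiff_eq_zero {μ : Measure (E d)} (hμ : levyMass μ < ∞) {z₀ : E d}
    (hz₀ : z₀ ∈ puncturedSupport μ) {U : E d → ℝ} {K L C : ℝ} (hU : Continuous U)
    (hK : ∀ x, |U x| ≤ K) (hL0 : 0 ≤ L)
    (hL : ∀ x z, |U (x + z) - U x| ≤ L * ‖z‖) (hC0 : 0 ≤ C)
    (hC : ∀ x z, |secondDiff U x z| ≤ C * levyWeight z)
    (h0 : ∀ x, ∫ z, secondDiff U x z ∂μ = 0) (x : E d) : U (x + z₀) ≤ U x := by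
  set v : E d → ℝ := fun x => U (x + z₀) - U x with hvdef
  have hv : Continuous v := by fun_prop
  have hvb : BddAbove (Set.range v) := by
    refine ⟨K + K, ?_⟩
    rintro _ ⟨y, rfl⟩
    have h1 := abs_le.1 (hK (y + z₀))
    have h2 := abs_le.1 (hK y)
    simp only [hvdef]
    linarith
  have hvL : ∀ x z, |v (x + z) - v x| ≤ (2 * L) * ‖z‖ := by
    intro x z
    have h1 := abs_le.1 (hL (x + z₀) z)
    have h2 := abs_le.1 (hL x z)
    simp only [hvdef, add_right_comm x z z₀, abs_le]
    constructor <;> linarith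
  have hsd : ∀ x z, secondDiff v x z = secondDiff U (x + z₀) z - secondDiff U x z := by
    intro x z
    simp only [secondDiff, hvdef, add_right_comm x z z₀, sub_add_eq_add_sub x z z₀]
    ring
  have hvC : ∀ x z, |secondDiff v x z| ≤ (2 * C) * levyWeight z := by
    intro x z
    have h1 := abs_le.1 (hC (x + z₀) z)
    have h2 := abs_le.1 (hC x z)
    rw [hsd, abs_le]
    constructor <;> linarith
  have hv0 : ∀ x, ∫ z, secondDiff v x z ∂μ = 0 := by
    intro x
    simp only [hsd]
    rw [integral_sub (integrable_secondDiff_right hμ hU (hC _))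
      (integrable_secondDiff_right hμ hU (hC _)), h0, h0, sub_zero]
  set M := sSup (Set.range v)
  have hM : ∀ y, v y ≤ M := fun y => le_csSup hvb ⟨y, rfl⟩
  suffices hM0 : M ≤ 0 by linarith [hM x]
  by_contra! hM0
  obtain ⟨k, hk⟩ := exists_nat_gt (2 * K / (M / 2))
  rw [div_lt_iff₀ (by positivity)] at hk
  obtain ⟨δ, hδ, H⟩ := exists_almost_max_nsmul hμ hz₀ hv (by positivity) hvL (by positivity) hvC hv0
    hM k (half_pos hM0)
  obtain ⟨_, ⟨y, rfl⟩, hy⟩ := exists_lt_of_lt_csSup (Set.range_nonempty v)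
    (sub_lt_self M hδ)
  have hsum : ∑ j ∈ Finset.range k, v (y + j • z₀) = U (y + k • z₀) - U y := by
    have := Finset.sum_range_sub (fun j : ℕ => U (y + j • z₀)) k
    simpa [hvdef, succ_nsmul, add_assoc] using this
  have hge : k * (M / 2) ≤ ∑ j ∈ Finset.range k, v (y + j • z₀) := by
    have := Finset.card_nsmul_le_sum (Finset.range k) (fun j => v (y + j • z₀)) (M / 2)
      (fun j hj => by linarith [H y hy j (Finset.mem_range.1 hj)])
    simpa using this
  have h1 := abs_le.1 (hK (y + k • z₀))
  have h2 := abs_le.1 (hK y)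
  linarith

/-- The inequality for `U` and for `-U`. -/
lemma eq_add_of_integral_secondDiff_eq_zero {μ : Measure (E d)} (hμ : levyMass μ < ∞) {z₀ : E d}
    (hz₀ : z₀ ∈ puncturedSupport μ) {U : E d → ℝ} {K L C : ℝ} (hU : Continuous U)
    (hK : ∀ x, |U x| ≤ K) (hL0 : 0 ≤ L)
    (hL : ∀ x z, |U (x + z) - U x| ≤ L * ‖z‖) (hC0 : 0 ≤ C)
    (hC : ∀ x z, |secondDiff U x z| ≤ C * levyWeight z)
    (h0 : ∀ x, ∫ z, secondDiff U x z ∂μ = 0) (x : E d) : U (x + z₀) = U x := by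
  refine le_antisymm (add_le_of_integral_secondDiff_eq_zero hμ hz₀ hU hK hL0 hL hC0 hC h0 x) ?_
  have hsd : ∀ x z, secondDiff (fun y => -U y) x z = -secondDiff U x z := by
    intro x z; simp only [secondDiff]; ring
  have := add_le_of_integral_secondDiff_eq_zero (U := fun y => -U y) hμ hz₀ hU.neg
    (fun x => by simpa using hK x) hL0
    (fun x z => by
      rw [show -U (x + z) - -U x = -(U (x + z) - U x) by ring, abs_neg]; exact hL x z) hC0
    (fun x z => by rw [hsd, abs_neg]; exact hC x z)
    (fun x => by simp only [hsd, integral_neg, h0, neg_zero]) x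
  linarith

/-! ### The group of periods of a bounded function -/

/-- Correlation of `u` with a test function; for fixed `φ` it is `u` mollified by the reflection of
`φ`. -/
noncomputable def corr (u φ : E d → ℝ) (x : E d) : ℝ := ∫ y, u y * φ (y - x)

lemma secondDiff_corr {u φ : E d → ℝ} (hu : MemLp u ∞ volume) (hφ : IsTest φ) (x z : E d) :
    secondDiff (corr u φ) x z = ∫ y, u y * secondDiff (fun y => φ (y - x)) y z := by
  have hi : ∀ a, Integrable fun y => u y * φ (y - a) := fun a =>
    integrable_bdd_mul hu (hφ.comp_sub_right a).integrable
  simp only [secondDiff, corr]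
  rw [← integral_const_mul, ← integral_add (hi _) (hi _),
    ← integral_sub (by exact (hi _).add (hi _)) ((hi _).const_mul 2)]
  congr 1 with y
  rw [show y - (x + z) = y - z - x by abel, show y - (x - z) = y + z - x by abel]
  ring

lemma exists_abs_corr_sub_le {u φ : E d → ℝ} (hu : MemLp u ∞ volume) (hφ : IsTest φ) :
    ∃ L, 0 ≤ L ∧ ∀ x z, |corr u φ (x + z) - corr u φ x| ≤ L * ‖z‖ := by
  obtain ⟨K, hK0, hK⟩ := exists_ae_abs_le hu
  obtain ⟨L, hL0, hL⟩ := hφ.exists_integral_abs_diff_le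
  refine ⟨K * L, by positivity, fun x z => ?_⟩
  have h1 := (hφ.comp_sub_right (x + z)).integrable
  have h2 := (hφ.comp_sub_right x).integrable
  have h : corr u φ (x + z) - corr u φ x = ∫ y, u y * (φ (y - (x + z)) - φ (y - x)) := by
    simp only [corr, mul_sub]
    rw [integral_sub (integrable_bdd_mul hu h1) (integrable_bdd_mul hu h2)]
  rw [h, mul_assoc]
  refine (abs_integral_mul_le hK (h1.sub h2)).trans ?_
  gcongr
  have h3 := integral_sub_right_eq_self (μ := volume) (fun y => |φ (y + -z) - φ y|) x
  have h4 := hL (-z)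
  rw [norm_neg, ← h3] at h4
  refine le_trans (le_of_eq ?_) h4
  congr 1 with y
  rw [Pi.sub_apply, show y - (x + z) = y - x + -z by abel]

lemma exists_abs_secondDiff_corr_le {u φ : E d → ℝ} (hu : MemLp u ∞ volume) (hφ : IsTest φ) :
    ∃ C, 0 ≤ C ∧ ∀ x z, |secondDiff (corr u φ) x z| ≤ C * levyWeight z := by
  obtain ⟨K, hK0, hK⟩ := exists_ae_abs_le hu
  obtain ⟨C, hC0, hC⟩ := hφ.exists_integral_abs_secondDiff_le
  refine ⟨K * C, by positivity, fun x z => ?_⟩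
  rw [secondDiff_corr hu hφ, mul_assoc]
  refine (abs_integral_mul_le hK ((hφ.comp_sub_right x).integrable_secondDiff z)).trans ?_
  gcongr
  refine le_trans (le_of_eq ?_) (hC z)
  rw [← integral_sub_right_eq_self (fun y => |secondDiff φ y z|) x]
  congr 1 with y
  simp only [secondDiff, sub_add_eq_add_sub, sub_right_comm y z x]

lemma continuous_corr {u φ : E d → ℝ} (hu : MemLp u ∞ volume) (hφ : IsTest φ) :
    Continuous (corr u φ) := by
  obtain ⟨L, hL0, hL⟩ := exists_abs_corr_sub_le hu hφ
  refine (LipschitzWith.of_dist_le' (K := L) fun x y => ?_).continuous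
  simpa only [dist_eq_norm, Real.norm_eq_abs, add_sub_cancel] using hL y (x - y)

lemma exists_abs_corr_le {u φ : E d → ℝ} (hu : MemLp u ∞ volume) (hφ : IsTest φ) :
    ∃ K, ∀ x, |corr u φ x| ≤ K := by
  obtain ⟨K, hK0, hK⟩ := exists_ae_abs_le hu
  refine ⟨K * ∫ y, |φ y|, fun x => (abs_integral_mul_le hK (hφ.comp_sub_right x).integrable).trans
    (le_of_eq ?_)⟩
  rw [integral_sub_right_eq_self (fun y => |φ y|) x]

/-- The group of periods, in the sense of distributions, of a bounded function: the vectors that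
are periods of all its correlations with test functions. -/
noncomputable def periods (u : E d → ℝ) : AddSubgroup (E d) where
  carrier := {z | ∀ φ : E d → ℝ, IsTest φ → ∀ x, corr u φ (x + z) = corr u φ x}
  zero_mem' := fun φ _ x => by rw [add_zero]
  add_mem' := fun {a b} ha hb φ hφ x => by rw [← add_assoc, hb φ hφ, ha φ hφ]
  neg_mem' := fun {a} ha φ hφ x => by rw [← ha φ hφ (x + -a), neg_add_cancel_right]

lemma isClosed_periods {u : E d → ℝ} (hu : MemLp u ∞ volume) :
    IsClosed (periods u : Set (E d)) := by
  have : (periods u : Set (E d)) = ⋂ (φ : E d → ℝ) (_ : IsTest φ) (x : E d),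
      {z | corr u φ (x + z) = corr u φ x} := by
    ext z; simp only [Set.mem_iInter]; rfl
  rw [this]
  exact isClosed_iInter fun φ => isClosed_iInter fun hφ => isClosed_iInter fun x =>
    isClosed_eq ((continuous_corr hu hφ).comp (by fun_prop)) continuous_const

/-- Bounded solutions are periodic with respect to the support of the measure. -/
lemma puncturedSupport_subset_periods {μ : Measure (E d)} (hμ : IsSymmetricLevy μ) {u : E d → ℝ}
    (hu : MemLp u ∞ volume) (h : ∀ ψ : E d → ℝ, IsTest ψ → distOp μ u ψ = 0) :
    puncturedSupport μ ⊆ periods u := by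
  intro z₀ hz₀ φ hφ x
  have := sigmaFinite_of_levyMass hμ.mass hμ.radon.1
  have := isNegInvariant_of_symm hμ.symm
  obtain ⟨K, hK⟩ := exists_abs_corr_le hu hφ
  obtain ⟨L, hL0, hL⟩ := exists_abs_corr_sub_le hu hφ
  obtain ⟨C, hC0, hC⟩ := exists_abs_secondDiff_corr_le hu hφ
  refine eq_add_of_integral_secondDiff_eq_zero hμ.mass hz₀ (continuous_corr hu hφ) hK hL0 hL
    hC0 hC (fun x => ?_) x
  have h1 := h _ (hφ.comp_sub_right x)
  rw [distOp_eq hμ.mass hu (hφ.comp_sub_right x), integral_div] at h1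
  simp only [secondDiff_corr hu hφ]
  linarith

/-- A bounded function with every vector as a period is constant: its mollifications are constant,
and they converge to it almost everywhere. -/
lemma ae_const_of_periods_eq_top {u : E d → ℝ} (hu : MemLp u ∞ volume) (h : periods u = ⊤) :
    ∃ c : ℝ, u =ᵐ[volume] fun _ => c := by
  let φ : ℕ → ContDiffBump (0 : E d) := fun n =>
    { rIn := 1 / (n + 1 : ℝ) , rOut := 2 * (1 / (n + 1 : ℝ)), rIn_pos := by positivity
      rIn_lt_rOut := by have : 0 < 1 / (n + 1 : ℝ) := by positivity
                        linarith }
  have hloc : LocallyIntegrable u volume := by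
    obtain ⟨K, hK0, hK⟩ := exists_ae_abs_le hu
    exact ((locallyIntegrable_const K).mono hu.1 (by
      filter_upwards [hK] with x hx
      rwa [Real.norm_eq_abs, Real.norm_of_nonneg hK0]))
  have hlim := ContDiffBump.ae_convolution_tendsto_right_of_locallyIntegrable (φ := φ) (K := 2)
    (l := atTop)
    (by simpa only [mul_zero] using tendsto_one_div_add_atTop_nhds_zero_nat.const_mul (2 : ℝ))
    (Eventually.of_forall fun n => le_rfl) hloc
  have hconst : ∀ n x,
      convolution ((φ n).normed volume) u (ContinuousLinearMap.lsmul ℝ ℝ) volume x =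
      corr u ((φ n).normed volume) 0 := by
    intro n x
    have hφ : IsTest ((φ n).normed volume) :=
      ⟨(φ n).contDiff_normed, (φ n).hasCompactSupport_normed⟩
    have hx : x ∈ periods u := by rw [h]; trivial
    rw [← hx _ hφ 0, zero_add, convolution_eq_swap, corr]
    congr 1 with y
    rw [← (φ n).normed_neg, neg_sub]
    simp [mul_comm]
  simp only [hconst] at hlim
  obtain ⟨x₀, hx₀⟩ := hlim.exists
  exact ⟨u x₀, hlim.mono fun x hx => tendsto_nhds_unique hx hx₀⟩

/-! ### Closed subgroups of Euclidean space -/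

/-- The largest vector subspace contained in an additive subgroup. -/
def lineSubspace (G : AddSubgroup (E d)) : Submodule ℝ (E d) where
  carrier := {v | ∀ t : ℝ, t • v ∈ G}
  zero_mem' := fun t => by rw [smul_zero]; exact G.zero_mem
  add_mem' := fun {a b} ha hb t => by rw [smul_add]; exact G.add_mem (ha t) (hb t)
  smul_mem' := fun c {v} hv t => by rw [smul_smul]; exact hv _

lemma lineSubspace_le {G : AddSubgroup (E d)} {v : E d} (hv : v ∈ lineSubspace G) : v ∈ G := by
  simpa using hv 1

/-- The part of an additive subgroup orthogonal to its largest vector subspace. -/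
noncomputable def orthogonalPart (G : AddSubgroup (E d)) : AddSubgroup (E d) :=
  G ⊓ (lineSubspace G)ᗮ.toAddSubgroup

/-- If the subgroup had orthogonal elements `aₙ → 0`, the multiples `⌊t / |aₙ|⌋ aₙ` would
accumulate at a whole line of the closed subgroup orthogonal to its largest subspace. -/
lemma exists_le_norm_of_mem_orthogonalPart {G : AddSubgroup (E d)} (hG : IsClosed (G : Set (E d))) :
    ∃ c > 0, ∀ a ∈ orthogonalPart G, a ≠ 0 → c ≤ ‖a‖ := by
  by_contra! hcon
  have hpos : ∀ n : ℕ, 0 < 1 / (n + 1 : ℝ) := fun n => by positivity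
  choose a haΛ ha0 ha using fun n : ℕ => hcon _ (hpos n)
  have han : ∀ n, 0 < ‖a n‖ := fun n => norm_pos_iff.2 (ha0 n)
  have hatend : Tendsto (fun n => ‖a n‖) atTop (𝓝 0) :=
    squeeze_zero (fun n => norm_nonneg _) (fun n => (ha n).le)
      tendsto_one_div_add_atTop_nhds_zero_nat
  obtain ⟨w, hw, θ, hθ, hlim⟩ := (isCompact_sphere (0 : E d) 1).tendsto_subseq
    (x := fun n => (‖a n‖)⁻¹ • a n) (fun n => by
      rw [mem_sphere_zero_iff_norm, norm_smul, norm_inv, norm_norm,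
        inv_mul_cancel₀ (han n).ne'])
  have hworth : w ∈ (lineSubspace G)ᗮ :=
    (Submodule.isClosed_orthogonal _).mem_of_tendsto hlim
      (Eventually.of_forall fun n => Submodule.smul_mem _ _ (haΛ _).2)
  have hwline : w ∈ lineSubspace G := by
    intro t
    have h1 : Tendsto (fun n => t • ((‖a (θ n)‖)⁻¹ • a (θ n))) atTop (𝓝 (t • w)) :=
      hlim.const_smul t
    have h2 : Tendsto (fun n => t • ((‖a (θ n)‖)⁻¹ • a (θ n)) - ⌊t * (‖a (θ n)‖)⁻¹⌋ • a (θ n))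
        atTop (𝓝 0) := by
      refine squeeze_zero_norm (fun n => ?_) (hatend.comp hθ.tendsto_atTop)
      rw [smul_smul, ← Int.cast_smul_eq_zsmul ℝ, ← sub_smul, norm_smul, Function.comp_apply]
      refine mul_le_of_le_one_left (norm_nonneg _) ?_
      rw [Int.self_sub_floor, Real.norm_of_nonneg (Int.fract_nonneg _)]
      exact (Int.fract_lt_one _).le
    have h3 := h1.sub h2
    simp only [sub_sub_cancel, sub_zero] at h3
    exact hG.mem_of_tendsto h3 (Eventually.of_forall fun n => G.zsmul_mem (haΛ _).1 _)
  have : w = 0 := by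
    have := (Submodule.inf_orthogonal_eq_bot (lineSubspace G)).le ⟨hwline, hworth⟩
    simpa using this
  simp [this] at hw

lemma discreteTopology_of_le_norm {Λ : AddSubgroup (E d)} {c : ℝ} (hc : 0 < c)
    (h : ∀ a ∈ Λ, a ≠ 0 → c ≤ ‖a‖) : DiscreteTopology Λ := by
  refine discreteTopology_of_isOpen_singleton_zero ?_
  convert! (Metric.isOpen_ball (x := (0 : Λ)) (ε := c))
  ext x
  rw [Set.mem_singleton_iff, mem_ball_zero_iff]
  refine ⟨fun hx => by rw [hx, norm_zero]; exact hc, fun hx => ?_⟩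
  by_contra hx0
  exact absurd hx (not_lt.2 (h x x.2 fun h0 => hx0 (Subtype.ext h0)))

/-- A `ℤ`-basis of a discrete subgroup is linearly independent over `ℝ`, because the two ranks
agree. -/
lemma isRelativeLattice_of_le_norm {Λ : AddSubgroup (E d)} {c : ℝ} (hc : 0 < c)
    (h : ∀ a ∈ Λ, a ≠ 0 → c ≤ ‖a‖) : IsRelativeLattice Λ := by
  let L : Submodule ℤ (E d) := AddSubgroup.toIntSubmodule Λ
  have hdisc : DiscreteTopology L := discreteTopology_of_le_norm hc h
  let b := Module.finBasis ℤ L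
  let v : Fin (Module.finrank ℤ L) → E d := fun i => b i
  have hspan : Submodule.span ℤ (Set.range v) = L := by
    have h1 : Set.range v = L.subtype '' Set.range b := by rw [← Set.range_comp]; rfl
    rw [h1, ← Submodule.map_span, b.span_eq, Submodule.map_top, Submodule.range_subtype]
  have hli : LinearIndependent ℝ v := by
    rw [linearIndependent_iff_card_eq_finrank_span,
      Real.finrank_eq_int_finrank_of_discrete (by rw [hspan]; exact hdisc), Set.finrank, hspan,
      Fintype.card_fin]
  refine ⟨Submodule.span ℝ (Set.range v), _, Module.Basis.span hli, ?_⟩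
  simp only [Module.Basis.span_apply]
  change Λ = AddSubgroup.closure (Set.range v)
  rw [← Submodule.span_int_eq_addSubgroupClosure, hspan]
  rfl

lemma exists_sub_mem_lineSubspace {G : AddSubgroup (E d)} {z : E d} (hz : z ∈ G) :
    ∃ a ∈ orthogonalPart G, z - a ∈ lineSubspace G := by
  obtain ⟨y, hy, a, ha, rfl⟩ := (lineSubspace G).exists_add_mem_mem_orthogonal z
  refine ⟨a, ⟨?_, ha⟩, by rwa [add_sub_cancel_right]⟩
  simpa using G.sub_mem hz (lineSubspace_le hy)

/-! ### Layers and restrictions of the measure -/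

lemma isClosed_translate (V : Submodule ℝ (E d)) (a : E d) : IsClosed (translate V a) :=
  V.closed_of_finiteDimensional.preimage (continuous_id.sub continuous_const)

lemma measurableSet_translate (V : Submodule ℝ (E d)) (a : E d) :
    MeasurableSet (translate V a) := (isClosed_translate V a).measurableSet

lemma translate_zero (V : Submodule ℝ (E d)) : translate V 0 = (V : Set (E d)) := by
  ext z; simp [translate]

lemma neg_translate (V : Submodule ℝ (E d)) (a : E d) : -translate V a = translate V (-a) := by
  ext z
  rw [Set.mem_neg]
  change -z - a ∈ V ↔ z - -a ∈ V
  rw [← V.neg_mem_iff, neg_sub_left, neg_neg, sub_neg_eq_add, add_comm]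

lemma restrict_symm {μ : Measure (E d)} (h : ∀ B : Set (E d), MeasurableSet B → μ B = μ (-B))
    {S : Set (E d)} (hS : MeasurableSet S) (B : Set (E d)) (hB : MeasurableSet B) :
    μ.restrict S B = μ.restrict (-S) (-B) := by
  rw [Measure.restrict_apply hB, Measure.restrict_apply hB.neg, h _ (hB.inter hS), Set.inter_neg]

lemma isNegInvariant_restrict {μ : Measure (E d)}
    (h : ∀ B : Set (E d), MeasurableSet B → μ B = μ (-B)) {S : Set (E d)} (hS : MeasurableSet S)
    (hneg : -S = S) : (μ.restrict S).IsNegInvariant :=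
  isNegInvariant_of_symm fun B hB => by rw [restrict_symm h hS B hB, hneg]

lemma IsPuncturedRadon.restrict {μ : Measure (E d)} (h : IsPuncturedRadon μ) (S : Set (E d)) :
    IsPuncturedRadon (μ.restrict S) :=
  ⟨le_antisymm ((Measure.restrict_apply_le _ _).trans h.1.le) zero_le,
    fun K hK h0 => (Measure.restrict_apply_le _ _).trans_lt (h.2 K hK h0)⟩

lemma levyMass_restrict_lt_top {μ : Measure (E d)} (h : levyMass μ < ∞) (S : Set (E d)) :
    levyMass (μ.restrict S) < ∞ :=
  (lintegral_mono' Measure.restrict_le_self le_rfl).trans_lt h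

/-! ### Nonconstant periodic solutions -/

/-- A nonzero linear form vanishing on `V` and integral on `Λ`: modulo `V`, a basis of `Λ` stays
linearly independent, so one of its coordinates extends to the whole space. -/
lemma exists_linearMap_int {V : Submodule ℝ (E d)} {Λ : AddSubgroup (E d)}
    (hΛ : IsRelativeLattice Λ) (hV : V ≠ ⊤)
    (hVΛ : V ⊓ Submodule.span ℝ (Λ : Set (E d)) = ⊥) :
    ∃ l : E d →ₗ[ℝ] ℝ, l ≠ 0 ∧ (∀ v ∈ V, l v = 0) ∧ ∀ a ∈ Λ, ∃ n : ℤ, l a = n := by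
  obtain ⟨W, n, b, rfl⟩ := hΛ
  suffices H : ∃ l : E d →ₗ[ℝ] ℝ, l ≠ 0 ∧ (∀ v ∈ V, l v = 0) ∧ ∀ i, ∃ n : ℤ, l (b i) = n by
    obtain ⟨l, hl0, hlV, hlb⟩ := H
    refine ⟨l, hl0, hlV, fun a ha => ?_⟩
    induction ha using AddSubgroup.closure_induction with
    | mem x hx => obtain ⟨i, rfl⟩ := hx; exact hlb i
    | zero => exact ⟨0, by simp⟩
    | add x y _ _ hx hy =>
      obtain ⟨m, hm⟩ := hx
      obtain ⟨k, hk⟩ := hy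
      exact ⟨m + k, by rw [map_add, hm, hk]; push_cast; rfl⟩
    | neg x _ hx =>
      obtain ⟨m, hm⟩ := hx
      exact ⟨-m, by rw [map_neg, hm]; push_cast; rfl⟩
  cases n with
  | zero =>
    -- the lattice is trivial, and any form vanishing on the proper subspace `V` will do
    obtain ⟨l, hl0, hl⟩ := V.exists_le_ker_of_lt_top (lt_top_iff_ne_top.2 hV)
    exact ⟨l, hl0, fun v hv => hl hv, fun i => i.elim0⟩
  | succ n =>
    have hW : W ≤ Submodule.span ℝ
        (AddSubgroup.closure (Set.range fun i => (b i : E d)) : Set (E d)) := by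
      intro w hw
      have hsum : w = ∑ i, b.repr ⟨w, hw⟩ i • (b i : E d) := by
        conv_lhs => rw [show w = W.subtype ⟨w, hw⟩ from rfl, ← b.sum_repr ⟨w, hw⟩]
        simp only [map_sum, map_smul, Submodule.subtype_apply]
      rw [hsum]
      exact Submodule.sum_mem _ fun i _ => Submodule.smul_mem _ _
        (Submodule.subset_span (AddSubgroup.subset_closure ⟨i, rfl⟩))
    obtain ⟨g, hg⟩ := (V.mkQ ∘ₗ W.subtype).exists_leftInverse_of_injective (by
      refine LinearMap.ker_eq_bot'.2 fun w hw => ?_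
      have hwV : (w : E d) ∈ V := by simpa using hw
      have : (w : E d) ∈ (⊥ : Submodule ℝ (E d)) := hVΛ ▸ ⟨hwV, hW w.2⟩
      simpa using this)
    have hgb : ∀ i, g (V.mkQ (b i)) = b i := fun i => LinearMap.congr_fun hg (b i)
    refine ⟨b.coord 0 ∘ₗ g ∘ₗ V.mkQ, fun h0 => ?_, fun v hv => ?_, fun i => ?_⟩
    · have := LinearMap.congr_fun h0 (b 0)
      simp only [LinearMap.comp_apply, hgb] at this
      simp at this
    · simp only [LinearMap.comp_apply, Submodule.mkQ_apply]
      rw [(Submodule.Quotient.mk_eq_zero V).2 hv, map_zero, map_zero]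
    · simp only [LinearMap.comp_apply, hgb]
      refine ⟨if i = 0 then 1 else 0, ?_⟩
      rw [Module.Basis.coord_apply, Module.Basis.repr_self, Finsupp.single_apply]
      split_ifs <;> simp

lemma exists_periodic_not_ae_const {V : Submodule ℝ (E d)} {Λ : AddSubgroup (E d)}
    (hΛ : IsRelativeLattice Λ) (hV : V ≠ ⊤)
    (hVΛ : V ⊓ Submodule.span ℝ (Λ : Set (E d)) = ⊥) :
    ∃ u : E d → ℝ, MemLp u ∞ volume ∧ (¬ ∃ c : ℝ, u =ᵐ[volume] fun _ => c) ∧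
      ∀ a ∈ Λ, ∀ z ∈ translate V a, ∀ x, u (x + z) = u x := by
  obtain ⟨l, hl0, hlV, hlΛ⟩ := exists_linearMap_int hΛ hV hVΛ
  have hlc : Continuous l := l.continuous_of_finiteDimensional
  have huc : Continuous fun x => Real.cos (l x * (2 * Real.pi)) := by fun_prop
  refine ⟨fun x => Real.cos (l x * (2 * Real.pi)),
    memLp_top_of_bound huc.aestronglyMeasurable 1 (ae_of_all _ fun x => Real.abs_cos_le_one _),
    ?_, fun a ha z hz x => ?_⟩
  · rintro ⟨c, hc⟩
    have h := congrFun ((Continuous.ae_eq_iff_eq volume huc continuous_const).1 hc)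
    obtain ⟨y, hy⟩ : ∃ y, l y ≠ 0 := by
      by_contra! hcon
      exact hl0 (LinearMap.ext hcon)
    have h0 := h 0
    have h1 := h ((1 / (2 * l y)) • y)
    simp only [map_zero, zero_mul, Real.cos_zero, map_smul, smul_eq_mul] at h0 h1
    rw [show 1 / (2 * l y) * l y * (2 * Real.pi) = Real.pi by field_simp, Real.cos_pi] at h1
    linarith
  · obtain ⟨n, hn⟩ := hlΛ a ha
    have : l z = n := by rw [← hn, ← sub_eq_zero, ← map_sub]; exact hlV _ hz
    simp only [map_add, this, add_mul, Real.cos_add_int_mul_two_pi]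

/-- Translating the variable moves the second difference from `ψ` to `u`. -/
lemma integral_mul_secondDiff_eq_zero {u ψ : E d → ℝ} (hu : MemLp u ∞ volume) (hψ : IsTest ψ)
    {z : E d} (hz : ∀ x, u (x + z) = u x) : ∫ x, u x * secondDiff ψ x z = 0 := by
  have hz' : ∀ x, u (x - z) = u x := fun x => by rw [← hz (x - z), sub_add_cancel]
  have h1 := integrable_bdd_mul hu (hψ.comp_add_right z).integrable
  have h2 := integrable_bdd_mul hu (hψ.comp_sub_right z).integrable
  have h3 := integrable_bdd_mul hu hψ.integrable
  have e1 : ∫ x, u x * ψ (x + z) = ∫ x, u x * ψ x := by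
    rw [← integral_add_right_eq_self (fun x => u x * ψ x) z]; simp only [hz]
  have e2 : ∫ x, u x * ψ (x - z) = ∫ x, u x * ψ x := by
    rw [← integral_sub_right_eq_self (fun x => u x * ψ x) z]; simp only [hz']
  have : ∀ x, u x * secondDiff ψ x z = u x * ψ (x + z) + u x * ψ (x - z) - 2 * (u x * ψ x) :=
    fun x => by rw [secondDiff]; ring
  simp only [this]
  rw [integral_sub (by exact h1.add h2) (h3.const_mul 2), integral_add h1 h2, integral_const_mul,
    e1, e2]
  ring

lemma distOp_eq_zero_of_periodic {ν : Measure (E d)} [SFinite ν] [ν.IsNegInvariant]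
    (hν : levyMass ν < ∞) {u ψ : E d → ℝ} (hu : MemLp u ∞ volume) (hψ : IsTest ψ)
    (h : ∀ᵐ z ∂ν, ∀ x, u (x + z) = u x) : distOp ν u ψ = 0 := by
  rw [distOp_eq hν hu hψ]
  refine integral_eq_zero_of_ae ?_
  filter_upwards [h] with z hz
  rw [integral_mul_secondDiff_eq_zero hu hψ hz, zero_div, Pi.zero_apply]

lemma distLayer_eq_zero_of_periodic {V : Submodule ℝ (E d)} {a : E d} {ν : Measure (E d)}
    {u ψ : E d → ℝ} (h : ∀ z ∈ translate V a, ∀ x, u (x + z) = u x) :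
    distLayer V a ν u ψ = 0 := by
  have : ∀ x, ∫ z in translate V a, (u (x + z) - u x) ∂ν = 0 := fun x =>
    setIntegral_eq_zero_of_forall_eq_zero fun z hz => by rw [h z hz x, sub_self]
  simp [distLayer, this]

/-! ### The layer decomposition -/

/-- Fubini and a translation move the difference from `u` to the test function. -/
lemma distLayer_eq {V : Submodule ℝ (E d)} {a : E d} {ν : Measure (E d)}
    [IsFiniteMeasure (ν.restrict (translate V a))] {u ψ : E d → ℝ} (hu : MemLp u ∞ volume)
    (hψ : IsTest ψ) :
    distLayer V a ν u ψ = ∫ z in translate V a, (corr u ψ z - corr u ψ 0) ∂ν := by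
  set κ := ν.restrict (translate V a)
  obtain ⟨K, hK0, hK⟩ := exists_ae_abs_le hu
  have hadd : Measure.QuasiMeasurePreserving (fun p : E d × E d => p.1 + p.2)
      (κ.prod volume) volume := quasiMeasurePreserving_add κ volume
  have hsnd : Measure.QuasiMeasurePreserving Prod.snd (κ.prod (volume : Measure (E d))) volume :=
    Measure.quasiMeasurePreserving_snd
  have hψi : Integrable (fun p : E d × E d => ψ p.2) (κ.prod volume) := hψ.integrable.comp_snd κ
  have hi : Integrable (fun p : E d × E d => (u (p.1 + p.2) - u p.2) * ψ p.2) (κ.prod volume) := by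
    simp only [sub_mul]
    exact (hψi.bdd_mul (hu.1.comp_quasiMeasurePreserving hadd) (hadd.ae hK)).sub
      (hψi.bdd_mul (hu.1.comp_quasiMeasurePreserving hsnd) (hsnd.ae hK))
  calc distLayer V a ν u ψ = ∫ x, ∫ z, (u (z + x) - u x) * ψ x ∂κ := by
        simp only [distLayer, integral_mul_const, add_comm]; rfl
    _ = ∫ z, (∫ x, (u (z + x) - u x) * ψ x) ∂κ := Eq.symm
        (integral_integral_swap (f := fun z x => (u (z + x) - u x) * ψ x) hi)
    _ = _ := by
        refine integral_congr_ae (ae_of_all _ fun z => ?_)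
        have h1 := integrable_bdd_mul hu (hψ.comp_sub_right z).integrable
        have h2 := h1.comp_add_left z
        simp only [add_sub_cancel_left] at h2
        simp only [sub_mul, corr, sub_zero]
        rw [integral_sub h2 (integrable_bdd_mul hu hψ.integrable),
          ← integral_add_left_eq_self (fun x => u x * ψ (x - z)) z]
        simp only [add_sub_cancel_left]

lemma integral_mul_secondDiff_eq_corr {u ψ : E d → ℝ} (hu : MemLp u ∞ volume) (hψ : IsTest ψ)
    (z : E d) : ∫ x, u x * secondDiff ψ x z =
      (corr u ψ z - corr u ψ 0) + (corr u ψ (-z) - corr u ψ 0) := by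
  have h := secondDiff_corr hu hψ 0 z
  simp only [sub_zero] at h
  rw [← h, secondDiff, zero_add, zero_sub]
  ring

lemma measure_compl_eq_zero_of_support {μ : Measure (E d)} {S : Set (E d)} (h0 : (0 : E d) ∈ S)
    (hS : puncturedSupport μ ⊆ S) : μ Sᶜ = 0 := by
  refine measure_null_of_locally_null _ fun x hx => ?_
  have hx0 : x ≠ 0 := fun h => hx (h ▸ h0)
  have : x ∉ puncturedSupport μ := fun h => hx (hS h)
  simp only [puncturedSupport, Set.mem_ofPred_eq, not_and, not_forall] at this
  obtain ⟨r, hr, h⟩ := this hx0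
  exact ⟨_, mem_nhdsWithin_of_mem_nhds (Metric.ball_mem_nhds x hr), by simpa using h⟩

/-- Away from the origin the principal value is not needed: on a symmetric set of finite mass the
two halves of the second difference contribute equally. -/
lemma setIntegral_secondDiff_eq {μ : Measure (E d)}
    (hsymm : ∀ B : Set (E d), MeasurableSet B → μ B = μ (-B)) {S : Set (E d)}
    (hS : MeasurableSet S) (hneg : -S = S) (hfin : μ S < ∞) {u ψ : E d → ℝ}
    (hu : MemLp u ∞ volume) (hψ : IsTest ψ) :
    IntegrableOn (fun z => corr u ψ z - corr u ψ 0) S μ ∧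
      ∫ z in S, (∫ x, u x * secondDiff ψ x z) / 2 ∂μ =
        ∫ z in S, (corr u ψ z - corr u ψ 0) ∂μ := by
  have := isNegInvariant_restrict hsymm hS hneg
  have : IsFiniteMeasure (μ.restrict S) := ⟨by simpa using hfin⟩
  obtain ⟨K, hK⟩ := exists_abs_corr_le hu hψ
  have hi : Integrable (fun z => corr u ψ z - corr u ψ 0) (μ.restrict S) :=
    Integrable.of_bound ((continuous_corr hu hψ).sub continuous_const).aestronglyMeasurable
      (K + K) (ae_of_all _ fun z => (norm_sub_le _ _).trans (add_le_add (hK _) (hK _)))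
  refine ⟨hi, ?_⟩
  have hrefl := integral_neg_eq_self (fun z => corr u ψ z - corr u ψ 0) (μ.restrict S)
  simp only [integral_mul_secondDiff_eq_corr hu hψ]
  rw [integral_div, integral_add hi hi.comp_neg, hrefl]
  ring

/-- The layer form of `L^μ` when disjoint layers `V + a`, `a ∈ Λ`, carry `μ` and those with `a ≠ 0`
have finite total mass. -/
lemma hasLayerForm_restrict {μ : Measure (E d)} (hμ : IsSymmetricLevy μ)
    {V : Submodule ℝ (E d)} {Λ : AddSubgroup (E d)} [Countable Λ]
    (hdisj : Pairwise (Function.onFun Disjoint fun a : Λ => translate V (a : E d)))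
    (hfin : μ (⋃ a : {a : Λ // a ≠ 0}, translate V (a.1 : E d)) < ∞)
    (hsupp : puncturedSupport μ ⊆ ⋃ a : Λ, translate V (a : E d)) :
    HasLayerForm μ V Λ fun a => μ.restrict (translate V (a : E d)) := by
  intro u hu ψ hψ
  set Z : Set (E d) := ⋃ a : {a : Λ // a ≠ 0}, translate V (a.1 : E d) with hZ
  have hZm : MeasurableSet Z := MeasurableSet.iUnion fun a => measurableSet_translate V _
  have hVm : MeasurableSet (V : Set (E d)) := V.closed_of_finiteDimensional.measurableSet
  have hZneg : -Z = Z := by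
    have hmem : ∀ z ∈ Z, -z ∈ Z := fun z hz => by
      obtain ⟨a, ha⟩ := Set.mem_iUnion.1 hz
      refine Set.mem_iUnion.2 ⟨⟨-a.1, neg_ne_zero.2 a.2⟩, ?_⟩
      rw [NegMemClass.coe_neg, ← neg_translate]
      simpa using ha
    exact Set.ext fun z => ⟨fun hz => by simpa using hmem _ hz, hmem z⟩
  have hdisjVZ : Disjoint (V : Set (E d)) Z := by
    rw [hZ, Set.disjoint_iUnion_right]
    intro a
    have := hdisj (Ne.symm a.2)
    simpa only [Function.onFun, ZeroMemClass.coe_zero, translate_zero] using this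
  have hnull : μ ((V : Set (E d)) ∪ Z)ᶜ = 0 := by
    refine measure_compl_eq_zero_of_support (Or.inl V.zero_mem) (hsupp.trans ?_)
    refine Set.iUnion_subset fun a => ?_
    by_cases ha : a = 0
    · rw [ha, ZeroMemClass.coe_zero, translate_zero]; exact Set.subset_union_left
    · exact Set.subset_union_of_subset_right
        (Set.subset_iUnion (fun a : {a : Λ // a ≠ 0} => translate V (a.1 : E d)) ⟨a, ha⟩) _
  have hσ := sigmaFinite_of_levyMass hμ.mass hμ.radon.1
  have hνinv := isNegInvariant_of_symm hμ.symm
  have hVinv := isNegInvariant_restrict hμ.symm hVm (by ext z; simp)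
  have hint := (integrable_integral_mul_secondDiff hμ.mass hu hψ).div_const 2
  have hZint := setIntegral_secondDiff_eq hμ.symm hZm hZneg hfin hu hψ
  have hlayer : ∀ a : {a : Λ // a ≠ 0},
      distLayer V (a.1 : E d) (μ.restrict (translate V (a.1 : E d))) u ψ =
        ∫ z in translate V (a.1 : E d), (corr u ψ z - corr u ψ 0) ∂μ := by
    intro a
    have h2 : (μ.restrict (translate V (a.1 : E d))).restrict (translate V (a.1 : E d)) =
        μ.restrict (translate V (a.1 : E d)) := by
      rw [Measure.restrict_restrict (measurableSet_translate V _), Set.inter_self]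
    have : IsFiniteMeasure ((μ.restrict (translate V (a.1 : E d))).restrict
        (translate V (a.1 : E d))) := by
      rw [h2]
      refine ⟨?_⟩
      rw [Measure.restrict_apply_univ]
      exact (measure_mono (Set.subset_iUnion
        (fun a : {a : Λ // a ≠ 0} => translate V (a.1 : E d)) a)).trans_lt hfin
    rw [distLayer_eq hu hψ, h2]
  have hsum : HasSum
      (fun a : {a : Λ // a ≠ 0} =>
        distLayer V (a.1 : E d) (μ.restrict (translate V (a.1 : E d))) u ψ)
      (∫ z in Z, (corr u ψ z - corr u ψ 0) ∂μ) := by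
    simp only [hlayer]
    exact hasSum_integral_iUnion (fun a => measurableSet_translate V _)
      (fun a b hab => hdisj (Subtype.coe_injective.ne hab)) hZint.1
  refine ⟨hsum.summable, ?_⟩
  have hV0 : (μ.restrict (translate V ((0 : Λ) : E d))).restrict (V : Set (E d)) =
      μ.restrict (V : Set (E d)) := by
    rw [ZeroMemClass.coe_zero, translate_zero, Measure.restrict_restrict hVm, Set.inter_self]
  have hcarry : μ.restrict ((V : Set (E d)) ∪ Z) = μ :=
    Measure.restrict_eq_self_of_ae_mem (mem_ae_iff.2 hnull)
  rw [hsum.tsum_eq, hV0, distOp_eq hμ.mass hu hψ,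
    distOp_eq (levyMass_restrict_lt_top hμ.mass _) hu hψ, ← hZint.2,
    ← setIntegral_union hdisjVZ hZm hint.integrableOn hint.integrableOn, hcarry]

/-! ### Both implications -/

lemma LiouvilleFails.exists_layers {μ : Measure (E d)} (hμ : IsSymmetricLevy μ)
    (hfails : LiouvilleFails μ) :
    ∃ (V : Submodule ℝ (E d)) (Λ : AddSubgroup (E d))
      (μs : Λ → Measure (E d)),
      IsRelativeLattice Λ ∧
      (∀ a : Λ, IsPuncturedRadon (μs a)) ∧
      V ≠ ⊤ ∧
      V ⊓ Submodule.span ℝ (Λ : Set (E d)) = ⊥ ∧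
      (∀ (a : Λ) (B : Set (E d)), MeasurableSet B →
        μs a B = μs (-a) (-B)) ∧
      (∀ a : Λ, puncturedSupport (μs a)
        ⊆ translate V (a : E d)) ∧
      levyMass (μs 0) + ∑' a : {a : Λ // a ≠ 0}, μs a.1 Set.univ < ⊤ ∧
      HasLayerForm μ V Λ μs := by
  obtain ⟨u, hu, hconst, h⟩ := hfails
  have hG := isClosed_periods hu
  obtain ⟨c, hc, hΛc⟩ := exists_le_norm_of_mem_orthogonalPart hG
  set V := lineSubspace (periods u)
  set Λ := orthogonalPart (periods u)
  have hdiscr : DiscreteTopology Λ := discreteTopology_of_le_norm hc hΛc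
  have hcount : Countable Λ := countable_of_Lindelof_of_discrete
  have hdisj : Pairwise (Function.onFun Disjoint fun a : Λ => translate V (a : E d)) := by
    intro a b hab
    refine Set.disjoint_left.2 fun z hza hzb => hab (Subtype.ext ?_)
    have h1 : (a : E d) - b ∈ V := by
      have := V.sub_mem hzb hza
      rwa [sub_sub_sub_cancel_left] at this
    have h2 : (a : E d) - b ∈ Vᗮ := Vᗮ.sub_mem a.2.2 b.2.2
    have h3 : (a : E d) - b ∈ (⊥ : Submodule ℝ (E d)) := V.inf_orthogonal_eq_bot ▸ ⟨h1, h2⟩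
    exact sub_eq_zero.1 (by simpa using h3)
  have hfin : μ (⋃ a : {a : Λ // a ≠ 0}, translate V (a.1 : E d)) < ∞ := by
    refine (measure_mono (Set.iUnion_subset fun a z hz => ?_)).trans_lt
      (measure_norm_gt_lt_top hμ.mass (half_pos hc))
    have h1 : c ≤ ‖(a.1 : E d)‖ := hΛc _ a.1.2 fun h0 => a.2 (Subtype.ext h0)
    -- `a` is the orthogonal projection of `z`
    have h2 : ‖(a.1 : E d)‖ ≤ ‖z‖ := by
      have h3 : inner ℝ (z - (a.1 : E d)) (a.1 : E d) = 0 := a.1.2.2 _ hz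
      have h4 := norm_add_sq_eq_norm_sq_add_norm_sq_of_inner_eq_zero _ _ h3
      rw [sub_add_cancel] at h4
      nlinarith [norm_nonneg z, norm_nonneg (a.1 : E d), norm_nonneg (z - (a.1 : E d))]
    show c / 2 < ‖z‖
    linarith
  refine ⟨V, Λ, fun a => μ.restrict (translate V (a : E d)),
    isRelativeLattice_of_le_norm hc hΛc, fun a => hμ.radon.restrict _, fun hV => ?_, ?_,
    fun a B hB => ?_, fun a z hz => ?_, ?_, hasLayerForm_restrict hμ hdisj hfin ?_⟩
  · refine hconst (ae_const_of_periods_eq_top hu (top_le_iff.1 fun z _ => ?_))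
    exact lineSubspace_le (hV ▸ Submodule.mem_top : z ∈ V)
  · refine le_bot_iff.1 ((inf_le_inf_left V (Submodule.span_le.2 fun a ha => ?_)).trans
      V.inf_orthogonal_eq_bot.le)
    exact ha.2
  · rw [restrict_symm hμ.symm (measurableSet_translate V _) B hB, neg_translate]
    rfl
  · by_contra hcon
    obtain ⟨r, hr, hball⟩ :=
      Metric.isOpen_iff.1 (isClosed_translate V (a : E d)).isOpen_compl z hcon
    refine (hz.2 r hr).ne' ?_
    rw [Measure.restrict_apply measurableSet_ball,
      (Set.disjoint_left.2 fun w hw => hball hw).inter_eq, measure_empty]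
  · refine ENNReal.add_lt_top.2 ⟨levyMass_restrict_lt_top hμ.mass _, ?_⟩
    simp only [Measure.restrict_apply_univ]
    rwa [← measure_iUnion (f := fun a : {a : Λ // a ≠ 0} => translate V (a.1 : E d))
      (fun a b hab => hdisj (Subtype.coe_injective.ne hab))
      (fun a => measurableSet_translate V _)]
  · intro z hz
    obtain ⟨a, ha, hza⟩ := exists_sub_mem_lineSubspace (puncturedSupport_subset_periods hμ hu h hz)
    exact Set.mem_iUnion.2 ⟨⟨a, ha⟩, hza⟩

lemma liouvilleFails_of_layers {μ : Measure (E d)} {V : Submodule ℝ (E d)}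
    {Λ : AddSubgroup (E d)} {μs : Λ → Measure (E d)} (hΛ : IsRelativeLattice Λ)
    (hrad : IsPuncturedRadon (μs 0)) (hV : V ≠ ⊤)
    (hVΛ : V ⊓ Submodule.span ℝ (Λ : Set (E d)) = ⊥)
    (hsymm : ∀ B : Set (E d), MeasurableSet B → μs 0 B = μs 0 (-B))
    (hmass : levyMass (μs 0) < ∞) (hform : HasLayerForm μ V Λ μs) : LiouvilleFails μ := by
  obtain ⟨u, hu, hconst, hper⟩ := exists_periodic_not_ae_const hΛ hV hVΛ
  refine ⟨u, hu, hconst, fun ψ hψ => ?_⟩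
  have hVm : MeasurableSet (V : Set (E d)) := V.closed_of_finiteDimensional.measurableSet
  have hmass0 : levyMass ((μs 0).restrict (V : Set (E d))) < ∞ :=
    levyMass_restrict_lt_top hmass _
  have hσ := sigmaFinite_of_levyMass hmass0 (hrad.restrict _).1
  have hinv := isNegInvariant_restrict hsymm hVm
    (by ext z; simp)
  rw [(hform u hu ψ hψ).2, distOp_eq_zero_of_periodic hmass0 hu hψ, zero_add]
  · refine (tsum_congr fun a => distLayer_eq_zero_of_periodic (hper _ a.1.2)).trans tsum_zero
  · filter_upwards [ae_restrict_mem hVm] with z hz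
    exact hper 0 Λ.zero_mem z (by rwa [translate_zero])

end LevyLiouville

theorem theorem4p10 (d : ℕ) (hd : 1 ≤ d) (μ : MeasureTheory.Measure (LevyLiouville.E d))
    (hμ : LevyLiouville.IsSymmetricLevy μ) :
    LevyLiouville.LiouvilleFails μ ↔
      ∃ (V : Submodule ℝ (LevyLiouville.E d)) (Λ : AddSubgroup (LevyLiouville.E d))
        (μs : Λ → MeasureTheory.Measure (LevyLiouville.E d)),
        LevyLiouville.IsRelativeLattice Λ ∧
        (∀ a : Λ, LevyLiouville.IsPuncturedRadon (μs a)) ∧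
        V ≠ ⊤ ∧
        V ⊓ Submodule.span ℝ (Λ : Set (LevyLiouville.E d)) = ⊥ ∧
        (∀ (a : Λ) (B : Set (LevyLiouville.E d)), MeasurableSet B →
          μs a B = μs (-a) (-B)) ∧
        (∀ a : Λ, LevyLiouville.puncturedSupport (μs a)
          ⊆ LevyLiouville.translate V (a : LevyLiouville.E d)) ∧
        LevyLiouville.levyMass (μs 0) + ∑' a : {a : Λ // a ≠ 0}, μs a.1 Set.univ < ⊤ ∧
        LevyLiouville.HasLayerForm μ V Λ μs := by
  refine ⟨fun h => h.exists_layers hμ, ?_⟩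
  rintro ⟨V, Λ, μs, hΛ, hrad, hV, hVΛ, hsymm, -, hmass, hform⟩
  exact LevyLiouville.liouvilleFails_of_layers hΛ (hrad 0) hV hVΛ
    (fun B hB => by simpa using hsymm 0 B hB) (ENNReal.add_lt_top.1 hmass).1 hform
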